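/- **Setting.** A seller has $k$ identical items; there are $n$ unit-demand buyers whose valuations $v_1,\dots,v_n$ are i.i.d. with distribution $F$ on $\mathbb{R}_+$. $F$ has a density $f>0$ on its support $[\underline v,\overline v]$, $0\le\underline v<\overline v\le\infty$, and is $\lambda$-regular for some $\lambda\in[0,1)$: the map $v\mapsto \lambda v-\frac{1-F(v)}{f(v)}$ is non-decreasing on the support. Let $c(\lambda)=(1-\lambda)^{1/\lambda}$ for $\lambda\in(0,1)$ and $c(0)=1/e$. The optimal welfare is $\mathrm{Wel}(F)=\mathbb{E}\big[\sum_{j=1}^{k} v^{(j)}\big]$, where $v^{(j)}$ is the $j$-th largest of $v_1,\dots,v_n$ (and $0$ for $j>n$). A demand structure $(m,\pi)$ consists of $m\le n$ intermediaries and a partition of the buyers into sets $\pi(1),\dots,\pi(m)$. Intermediary $l$ has a measurable utility $U_l(x,p;\mathbf v_l)$ for receiving $x\in\{0,\dots,k\}$ items at total price $p\ge 0$ when its buyers have valuations $\mathbf v_l=(v_i)_{i\in\pi(l)}$. The utilities are admissible with parameters $\tau_l\in(0,1]$ if, for every $l$: 1. $U_l(0,0;\mathbf v_l)=0$ for all $\mathbf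 v_l$; 2. $U_l(x,p;\mathbf v_l)\le \max\{\sum_{i\in\pi(l)}v_iz_i-p : z\in[0,1]^{\pi(l)},\ \sum_i z_i\le x\}$ for all $x,p,\mathbf v_l$; 3. for every $r\ge0$ and $q\in\{0,\dots,k\}$, if $D_l^{q,r}(\mathbf v_l)$ denotes the (largest) maximizer of $x\mapsto U_l(x,rx;\mathbf v_l)$ over $\{0,\dots,q\}$, i.e. the number of items that $l$ wants to purchase when $q$ items are offered at the uniform price $r$ per item, then $$\mathbb{E}\big[D_l^{q,r}(\mathbf v_l)\big]\ \ge\ \tau_l\,\mathbb{E}\big[\min\{q,\ |\{i\in\pi(l): v_i\ge r\}|\}\big].$$ A direct mechanism assigns measurably to each profile $\mathbf v$ of reported valuations a lottery $x(\mathbf v)$ over allocations of numbers of items to the intermediaries, which almost surely allocates at most $k$ items in total, and payments $p_l(\mathbf v)\ge 0$. Utilities are extended to lotteries by expectation. The mechanism is (BIC) if for all $l$ and all possible $\mathbf v_l,\mathbf v_l'$ $$\mathbb{E}\big[U_l(x_l(\mathbf v_l,\mathbf v_{-l}),p_l(\mathbf v_l,\mathbf v_{-l});\mathbf v_l)\mid\mathbf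 v_l\big]\ \ge\ \mathbb{E}\big[U_l(x_l(\mathbf v'_l,\mathbf v_{-l}),p_l(\mathbf v'_l,\mathbf v_{-l});\mathbf v_l)\mid\mathbf v_l\big]$$ and the left-hand side is nonnegative. The optimal revenue $\mathrm{Rev}(F,m,\pi)$ is the supremum of $\mathbb{E}\big[\sum_{l}p_l(\mathbf v)\big]$ over all (BIC) mechanisms. **Claim.** For all $n,k$, every such $F$ and $\lambda\in[0,1)$, every demand structure $(m,\pi)$, and all admissible utilities with parameters $\tau_1,\dots,\tau_m$, writing $\tau=\min_l\tau_l$, $$\mathrm{Rev}(F,m,\pi)\ \ge\ \tau\,\frac{c(\lambda)}{2}\Big(1-\frac1e\Big)\,\mathrm{Wel}(F).$$ -/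

import Mathlib

open MeasureTheory

namespace Intermediation

noncomputable section

/-! ## Value distributions -/

/-- The interval `[lo, hi]` of reals, where `hi` may be `⊤` (then it is `[lo, ∞)`). -/
def valueInterval (lo : ℝ) (hi : EReal) : Set ℝ := {v : ℝ | lo ≤ v ∧ (v : EReal) ≤ hi}

/-- A probability distribution on the nonnegative reals with a positive density on its support
`[lo, hi]`, where `lo < hi ≤ ∞`. -/
structure ValueDistribution where
  lo : ℝ
  hi : EReal
  density : ℝ → ℝ
  lo_nonneg : 0 ≤ lo
  lo_lt_hi : (lo : EReal) < hi
  measurable_density : Measurable density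
  density_pos : ∀ v ∈ valueInterval lo hi, 0 < density v
  mass_eq_one : ∫⁻ v in valueInterval lo hi, ENNReal.ofReal (density v) = 1

namespace ValueDistribution

/-- The support `[lo, hi]`, which is the set of possible valuations of a buyer. -/
def support (F : ValueDistribution) : Set ℝ := valueInterval F.lo F.hi

/-- The law of one valuation. -/
def law (F : ValueDistribution) : Measure ℝ :=
  (volume.restrict F.support).withDensity (fun v => ENNReal.ofReal (F.density v))

instance (F : ValueDistribution) : IsProbabilityMeasure F.law where
  measure_univ := by
    rw [law, withDensity_apply _ MeasurableSet.univ, Measure.restrict_univ]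
    exact F.mass_eq_one

/-- The cumulative distribution function. -/
def cdf (F : ValueDistribution) (v : ℝ) : ℝ := F.law.real (Set.Iic v)

/-- `lam`-regularity: `lam * v - (1 - F v) / f v` is nondecreasing on the support. For `lam = 0`
this is the monotone hazard rate condition, for `lam = 1` it is Myerson regularity. -/
def IsRegular (F : ValueDistribution) (lam : ℝ) : Prop :=
  MonotoneOn (fun v => lam * v - (1 - F.cdf v) / F.density v) F.support

end ValueDistribution

/-- `c(lam) = (1 - lam) ^ (1 / lam)`, with the limit value `1 / e` at `lam = 0`. -/
def regConst (lam : ℝ) : ℝ :=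
  if lam = 0 then 1 / Real.exp 1 else (1 - lam) ^ (1 / lam)

/-! ## Welfare -/

/-- The `(j + 1)`-st largest of the numbers `v 0, …, v (n - 1)`, and `0` if `j ≥ n`. -/
def orderStat {n : ℕ} (v : Fin n → ℝ) (j : ℕ) : ℝ :=
  if h : j < n then v (Tuple.sort v (Fin.rev ⟨j, h⟩)) else 0

/-- The expected optimal welfare: the expected sum of the `k` largest among `n` i.i.d.
valuations. -/
def welfare (F : ValueDistribution) (n k : ℕ) : ENNReal :=
  ∫⁻ v, ENNReal.ofReal (∑ j ∈ Finset.range k, orderStat v j) ∂(Measure.pi fun _ : Fin n => F.law)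

/-! ## Demand structures and utilities of intermediaries -/

/-- A demand structure: `m ≤ n` intermediaries and a partition of the `n` buyers among them;
buyer `i` is represented by intermediary `rep i`. -/
structure DemandStructure (n : ℕ) where
  m : ℕ
  m_le : m ≤ n
  rep : Fin n → Fin m

/-- The block of the partition that belongs to `l`: the buyers whom `l` represents. -/
abbrev DemandStructure.Buyers {n : ℕ} (D : DemandStructure n) (l : Fin D.m) : Type :=
  {i : Fin n // D.rep i = l}

/-- The profile in which the buyers of `l` have the valuations `t` and all other buyers have their
valuations from `w`. -/
def DemandStructure.combine {n : ℕ} (D : DemandStructure n) (l : Fin D.m)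
    (t : D.Buyers l → ℝ) (w : Fin n → ℝ) : Fin n → ℝ :=
  fun i => if h : D.rep i = l then t ⟨i, h⟩ else w i

/-- The surplus `V(x, p; t)`: the largest value of `∑ i, t i * z i - p` over all (fractional)
assignments `z` of at most `x` items to unit-demand buyers. -/
def surplus {ι : Type} [Fintype ι] (x : ℕ) (p : ℝ) (t : ι → ℝ) : ℝ :=
  sSup ((fun z : ι → ℝ => ∑ i, t i * z i - p) ''
    {z | (∀ i, z i ∈ Set.Icc (0 : ℝ) 1) ∧ ∑ i, z i ≤ (x : ℝ)})

open Classical in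
/-- The number of items that an intermediary with utility `u` and valuations `t` wants to purchase
when up to `q` items are offered at the uniform price `r` per item: the maximizer of
`x ↦ u x (r * x) t` over `{0, …, q}`, the largest one if there are several. -/
def demand {ι : Type} (u : ℕ → ℝ → (ι → ℝ) → ℝ) (q : ℕ) (r : ℝ) (t : ι → ℝ) : ℕ :=
  Nat.findGreatest (fun x => ∀ y ≤ q, u y (r * y) t ≤ u x (r * x) t) q

open Classical in
/-- The number of buyers whose valuation is at least `r`. -/
def numAbove {ι : Type} [Fintype ι] (r : ℝ) (t : ι → ℝ) : ℕ :=
  (Finset.univ.filter fun i => r ≤ t i).card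

/-- The conditions on the utilities `U l x p t` of the intermediaries (`x` items, total payment
`p`, valuations `t` of the represented buyers), with disconnectability parameters `τ l`. -/
structure Admissible {n : ℕ} (F : ValueDistribution) (k : ℕ) (D : DemandStructure n)
    (U : (l : Fin D.m) → ℕ → ℝ → (D.Buyers l → ℝ) → ℝ) (τ : Fin D.m → ℝ) : Prop where
  measurable : ∀ l, ∀ x ≤ k, Measurable fun y : ℝ × (D.Buyers l → ℝ) => U l x y.1 y.2
  /-- Individual rationality: no items and no payment give payoff zero. -/
  opt_out : ∀ l, ∀ t : D.Buyers l → ℝ, (∀ i, t i ∈ F.support) → U l 0 0 t = 0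
  /-- Intermediaries do not create value. -/
  le_surplus : ∀ l, ∀ t : D.Buyers l → ℝ, (∀ i, t i ∈ F.support) →
    ∀ x ≤ k, ∀ p : ℝ, 0 ≤ p → U l x p t ≤ surplus x p t
  tau_mem : ∀ l, τ l ∈ Set.Ioc (0 : ℝ) 1
  /-- Buyer-disconnectability: whenever `q` items are on offer at a uniform price `r` per item, the
  intermediary wants to purchase, in expectation, at least `τ l` times as many items as there are
  represented buyers with valuation at least `r` (as far as the `q` items go). -/
  disconnectable : ∀ l, ∀ q ≤ k, ∀ r : ℝ, 0 ≤ r →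
    τ l * ∫ t, ((min q (numAbove r t) : ℕ) : ℝ) ∂(Measure.pi fun _ : D.Buyers l => F.law) ≤
      ∫ t, (demand (U l) q r t : ℝ) ∂(Measure.pi fun _ : D.Buyers l => F.law)

/-! ## Mechanisms and revenue -/

/-- A direct mechanism: for each profile of reported valuations, a lottery over allocations of
numbers of items to the intermediaries, and a nonnegative payment for each intermediary. At most
`k` items are ever allocated, almost surely. -/
structure Mechanism {n : ℕ} (F : ValueDistribution) (k : ℕ) (D : DemandStructure n) where
  alloc : (Fin n → ℝ) → (Fin D.m → Fin (k + 1)) → ℝ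
  pay : Fin D.m → (Fin n → ℝ) → ℝ
  alloc_mem : ∀ v, alloc v ∈ stdSimplex ℝ (Fin D.m → Fin (k + 1))
  measurable_alloc : ∀ a, Measurable fun v => alloc v a
  pay_nonneg : ∀ l v, 0 ≤ pay l v
  measurable_pay : ∀ l, Measurable (pay l)
  feasible : ∀ᵐ v ∂(Measure.pi fun _ : Fin n => F.law),
    ∀ a, alloc v a ≠ 0 → ∑ l, (a l : ℕ) ≤ k

namespace Mechanism

variable {n k : ℕ} {F : ValueDistribution} {D : DemandStructure n}

/-- The expected utility (over the lottery) of intermediary `l` whose buyers have valuations `t`,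
when it reports `s` and the reports of the others are those in `w`. -/
def utility (M : Mechanism F k D) (U : (l : Fin D.m) → ℕ → ℝ → (D.Buyers l → ℝ) → ℝ)
    (l : Fin D.m) (s t : D.Buyers l → ℝ) (w : Fin n → ℝ) : ℝ :=
  ∑ a, M.alloc (D.combine l s w) a * U l (a l) (M.pay l (D.combine l s w)) t

/-- Bayesian incentive compatibility and interim individual rationality. Valuations are
independent, so the conditional expectation given the valuations of `l` is the integral over the
valuations of all other buyers. Under the conditions on the utilities the integrands are bounded
above, so a deviation that is not integrable has expected utility `-∞`. -/
def IsBIC (M : Mechanism F k D) (U : (l : Fin D.m) → ℕ → ℝ → (D.Buyers l → ℝ) → ℝ) : Prop :=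
  ∀ l, ∀ t : D.Buyers l → ℝ, (∀ i, t i ∈ F.support) →
    Integrable (M.utility U l t t) (Measure.pi fun _ : Fin n => F.law) ∧
    0 ≤ ∫ w, M.utility U l t t w ∂(Measure.pi fun _ : Fin n => F.law) ∧
    ∀ s : D.Buyers l → ℝ, (∀ i, s i ∈ F.support) →
      Integrable (M.utility U l s t) (Measure.pi fun _ : Fin n => F.law) →
      ∫ w, M.utility U l s t w ∂(Measure.pi fun _ : Fin n => F.law) ≤
        ∫ w, M.utility U l t t w ∂(Measure.pi fun _ : Fin n => F.law)

/-- The expected revenue of the seller. -/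
def revenue (M : Mechanism F k D) : ENNReal :=
  ∫⁻ v, ENNReal.ofReal (∑ l, M.pay l v) ∂(Measure.pi fun _ : Fin n => F.law)

end Mechanism

/-- The optimal expected revenue: the supremum over all incentive compatible and individually
rational direct mechanisms. -/
def optimalRevenue {n : ℕ} (F : ValueDistribution) (k : ℕ) (D : DemandStructure n)
    (U : (l : Fin D.m) → ℕ → ℝ → (D.Buyers l → ℝ) → ℝ) : ENNReal :=
  ⨆ (M : Mechanism F k D) (_ : M.IsBIC U), M.revenue

end

end Intermediation

/-! The lower bound comes from one mechanism: fix a price `r` per item and let the intermediaries,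
in a fixed order, buy as many of the remaining items as they like. The supply facing an intermediary
does not depend on its own report, so truthful demand is optimal (`postedPrice_isBIC`). Three
factors are lost.

The factor `τ / 2`: if `S` items are sold in all, then pathwise the direct sales `min k N` are at
most `S` plus the sum over `l` of the direct demand of block `l`, capped at the supply it meets
(`min_numAbove_le`). Disconnectability, applied conditionally on that supply, bounds `τ` times the
expected sum by the expectation of `S` (`le_integral_sold`).

The factor `1 - 1/e`: `N` is a sum of independent indicators, so capping it at `k` costs at most
this factor when its mean is at most `k` (`le_integral_min_numAbove`).

The factor `regConst lam`: welfare is at most `k * p` plus `n` times the mean of `max 0 (v - p)`,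
for every `p ≥ 0` (`welfare_le`). If expected demand at the monopoly price fits the supply, post
that price and take `p = 0`; the mean is controlled by monopoly revenue
(`regConst_mul_integral_tail_le`). Otherwise post the market-clearing price and take it as `p`;
regularity bounds the excess and `regConst_mul_le` closes the case (`exists_price`). -/

namespace Intermediation

open Set Filter Topology

/-! ### Tail integrals, the inverse hazard rate and the monopoly price. -/

namespace ValueDistribution

/-- The probability that a valuation is at least `v`. -/
noncomputable def tail (F : ValueDistribution) (v : ℝ) : ℝ := F.law.real (Ici v)

variable (F : ValueDistribution)

instance : NullSingletonClass F.law where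
  measure_singleton x :=
    ((withDensity_absolutelyContinuous _ _).trans Measure.restrict_le_self.absolutelyContinuous)
      (measure_singleton x)

theorem measurableSet_support : MeasurableSet F.support := by
  have : F.support = Ici F.lo ∩ (fun v : ℝ => (v : EReal)) ⁻¹' Iic F.hi := by
    ext v; simp [support, valueInterval]
  rw [this]
  exact measurableSet_Ici.inter (measurable_coe_real_ereal measurableSet_Iic)

theorem setLIntegral_law {s : Set ℝ} (hs : MeasurableSet s) {h : ℝ → ENNReal}
    (hh : Measurable h) :
    ∫⁻ v in s, h v ∂F.law =
      ∫⁻ v in s ∩ F.support, ENNReal.ofReal (F.density v) * h v := by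
  rw [law, setLIntegral_withDensity_eq_setLIntegral_mul _ F.measurable_density.ennreal_ofReal hh hs,
    Measure.restrict_restrict hs]
  rfl

theorem law_compl_support : F.law F.supportᶜ = 0 := by
  have := F.setLIntegral_law F.measurableSet_support.compl (h := fun _ => 1) measurable_const
  simpa using this

theorem tail_nonneg (v : ℝ) : 0 ≤ F.tail v := measureReal_nonneg

theorem tail_le_one (v : ℝ) : F.tail v ≤ 1 := measureReal_le_one

theorem tail_eq_Ioi (v : ℝ) : F.tail v = F.law.real (Ioi v) :=
  (measureReal_congr Ioi_ae_eq_Ici).symm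

theorem tail_eq_one_sub_cdf (v : ℝ) : F.tail v = 1 - F.cdf v := by
  rw [tail_eq_Ioi, cdf, ← compl_Iic, probReal_compl_eq_one_sub measurableSet_Iic]

theorem antitone_tail : Antitone F.tail := fun _ _ h =>
  measureReal_mono (Ici_subset_Ici.2 h)

theorem continuous_tail : Continuous F.tail := by
  have h := intervalIntegral.continuous_primitive (μ := F.law) (f := fun _ => (1 : ℝ))
    (fun a b => (integrable_const _).intervalIntegrable) 0
  have h2 : F.tail = fun b => 1 - F.cdf 0 - ∫ _ in (0 : ℝ)..b, (1 : ℝ) ∂F.law := by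
    funext b
    rw [← intervalIntegral.integral_Iic_sub_Iic (integrable_const _).integrableOn
      (integrable_const _).integrableOn, tail_eq_one_sub_cdf]
    simp [cdf]
  rw [h2]
  exact continuous_const.sub h

theorem tendsto_tail_atTop : Tendsto F.tail atTop (𝓝 0) := by
  have h := (ENNReal.tendsto_toReal ENNReal.one_ne_top).comp
    (tendsto_measure_Iic_atTop F.law |>.trans (by simp))
  have h2 : F.tail = fun v => 1 - F.cdf v := funext F.tail_eq_one_sub_cdf
  rw [h2]
  have := (tendsto_const_nhds (x := (1 : ℝ))).sub h
  simpa [cdf, Measure.real] using this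

theorem tail_eq_zero {v : ℝ} (hv : F.lo ≤ v) (hv' : v ∉ F.support) : F.tail v = 0 := by
  have : Ici v ⊆ F.supportᶜ := fun u hu hus => hv' ⟨hv, le_trans (by exact_mod_cast hu) hus.2⟩
  have := measure_mono_null this F.law_compl_support
  simp [tail, Measure.real, this]

theorem intervalIntegrable_tail (a b : ℝ) : IntervalIntegrable F.tail volume a b :=
  F.continuous_tail.intervalIntegrable a b

/-- Layer-cake formula. Truncation at `b` keeps everything integrable, although the mean is not
known to be finite. -/
theorem integral_tail_eq {a b : ℝ} (hab : a ≤ b) :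
    ∫ v, max 0 (min v b - a) ∂F.law = ∫ u in a..b, F.tail u := by
  have hb : ∀ v, max 0 (min v b - a) ≤ b - a := fun v =>
    max_le (by linarith) (by linarith [min_le_right v b])
  have hi : Integrable (fun v => max 0 (min v b - a)) F.law := by
    refine Integrable.of_bound (by fun_prop) (b - a) (ae_of_all _ fun v => ?_)
    rw [Real.norm_of_nonneg (le_max_left _ _)]
    exact hb v
  rw [hi.integral_eq_integral_Ioc_meas_le (ae_of_all _ fun v => le_max_left _ _)
    (ae_of_all _ hb), ← intervalIntegral.integral_of_le (by linarith)]
  have : ∫ u in a..b, F.tail u = ∫ t in (0 : ℝ)..(b - a), F.tail (t + a) := by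
    rw [intervalIntegral.integral_comp_add_right]; simp
  rw [this]
  refine intervalIntegral.integral_congr_ae (ae_of_all _ fun t ht => ?_)
  rw [uIoc_of_le (by linarith)] at ht
  simp only [tail]
  congr 1
  ext v
  simp only [mem_ofPred_eq, mem_Ici, le_max_iff, not_le.2 ht.1, false_or, le_sub_iff_add_le, le_min_iff]
  constructor
  · exact fun h => h.1
  · exact fun h => ⟨h, by linarith [ht.2]⟩

theorem integral_Ioc_sub {a b : ℝ} (hab : a ≤ b) :
    ∫ v in Ioc a b, (v - a) ∂F.law = (∫ u in a..b, F.tail u) - (b - a) * F.tail b := by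
  have hi : Integrable (fun v => max 0 (min v b - a)) F.law := by
    refine Integrable.of_bound (by fun_prop) (b - a) (ae_of_all _ fun v => ?_)
    rw [Real.norm_of_nonneg (le_max_left _ _)]
    exact max_le (by linarith) (by linarith [min_le_right v b])
  rw [← F.integral_tail_eq hab]
  have h1 : ∫ v in Iic a, max 0 (min v b - a) ∂F.law = 0 := by
    rw [setIntegral_congr_fun (g := fun _ => (0 : ℝ)) measurableSet_Iic]
    · simp
    · intro v hv
      exact max_eq_left (by linarith [min_le_left v b, mem_Iic.1 hv])
  have h2 : ∫ v in Ioc a b, max 0 (min v b - a) ∂F.law = ∫ v in Ioc a b, (v - a) ∂F.law := by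
    refine setIntegral_congr_fun measurableSet_Ioc fun v hv => ?_
    simp only [min_eq_left hv.2]
    exact max_eq_right (by linarith [hv.1])
  have h3 : ∫ v in Ioi b, max 0 (min v b - a) ∂F.law = (b - a) * F.tail b := by
    rw [setIntegral_congr_fun (g := fun _ => b - a) measurableSet_Ioi]
    · simp [tail_eq_Ioi, mul_comm]
    · intro v hv
      simp only [min_eq_right (le_of_lt (mem_Ioi.1 hv))]
      exact max_eq_right (by linarith)
  have h4 := integral_add_compl (μ := F.law) (measurableSet_Iic (a := a)) hi
  have h5 : ∫ v in Ioi a, max 0 (min v b - a) ∂F.law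
      = (∫ v in Ioc a b, max 0 (min v b - a) ∂F.law) + ∫ v in Ioi b, max 0 (min v b - a) ∂F.law := by
    rw [← setIntegral_union (Ioc_disjoint_Ioi le_rfl) measurableSet_Ioi hi.integrableOn
      hi.integrableOn, Ioc_union_Ioi_eq_Ioi hab]
  rw [compl_Iic, h1, h5, h2, h3] at h4
  linarith

theorem real_Ioc {a b : ℝ} (hab : a ≤ b) : F.law.real (Ioc a b) = F.tail a - F.tail b := by
  rw [tail_eq_Ioi, tail_eq_Ioi, ← Ioc_union_Ioi_eq_Ioi hab,
    measureReal_union (Ioc_disjoint_Ioi le_rfl) measurableSet_Ioi]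
  ring

/-- The density is only measurable, so the tail need not be differentiable everywhere. Integrating
affine bounds on the inverse hazard rate against the law replaces differential inequalities for the
tail. -/
theorem integral_Ioc_affine {a b : ℝ} (hab : a ≤ b) (c d : ℝ) :
    ∫ v in Ioc a b, (c + d * (v - a)) ∂F.law =
      c * (F.tail a - F.tail b) + d * ((∫ u in a..b, F.tail u) - (b - a) * F.tail b) := by
  have hi : IntegrableOn (fun v => v - a) (Ioc a b) F.law :=
    ((continuous_id.sub continuous_const).integrableOn_Icc).mono_set Ioc_subset_Icc_self
  rw [integral_add (integrable_const _) (hi.const_mul d), integral_const_mul, F.integral_Ioc_sub hab]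
  simp [real_Ioc F hab, mul_comm]

theorem integral_tail_eq_toReal {a b : ℝ} (hab : a ≤ b) :
    ENNReal.ofReal (∫ u in a..b, F.tail u) = ∫⁻ v in Ioc a b, ENNReal.ofReal (F.tail v) := by
  rw [intervalIntegral.integral_of_le hab, ofReal_integral_eq_lintegral_ofReal
    (F.intervalIntegrable_tail a b).1 (ae_of_all _ F.tail_nonneg)]

theorem ofReal_integral_Ioc_affine {a b c d : ℝ} (h0 : ∀ v ∈ Ioc a b, 0 ≤ c + d * (v - a)) :
    ENNReal.ofReal (∫ v in Ioc a b, (c + d * (v - a)) ∂F.law) =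
      ∫⁻ v in Ioc a b, ENNReal.ofReal (c + d * (v - a)) ∂F.law := by
  rw [ofReal_integral_eq_lintegral_ofReal]
  · exact (Continuous.integrableOn_Icc (by fun_prop)).mono_set Ioc_subset_Icc_self
  · exact (ae_restrict_iff' measurableSet_Ioc).2 (ae_of_all _ h0)

/-- An upper bound on the inverse hazard rate bounds the tail integral by an integral with respect
to the law. -/
theorem integral_tail_le_of_le {a b c d : ℝ} (hab : a ≤ b) (ha : F.lo ≤ a)
    (h0 : ∀ v ∈ Ioc a b, 0 ≤ c + d * (v - a))
    (h : ∀ v ∈ F.support, v ∈ Ioc a b → F.tail v ≤ (c + d * (v - a)) * F.density v) :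
    ∫ u in a..b, F.tail u ≤
      c * (F.tail a - F.tail b) + d * ((∫ u in a..b, F.tail u) - (b - a) * F.tail b) := by
  rw [← F.integral_Ioc_affine hab]
  refine (ENNReal.ofReal_le_ofReal_iff (setIntegral_nonneg measurableSet_Ioc h0)).1 ?_
  rw [F.integral_tail_eq_toReal hab, F.ofReal_integral_Ioc_affine h0,
    F.setLIntegral_law measurableSet_Ioc (by fun_prop),
    ← lintegral_inter_add_sdiff _ (Ioc a b) F.measurableSet_support]
  -- The hazard bound is silent off the support, but as `F.lo ≤ a` such points lie above the
  -- support, where the tail vanishes.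
  have h1 : ∫⁻ v in Ioc a b \ F.support, ENNReal.ofReal (F.tail v) = 0 := by
    rw [setLIntegral_congr_fun (g := fun _ => 0) (measurableSet_Ioc.diff F.measurableSet_support)]
    · simp
    · intro v hv
      simp only [F.tail_eq_zero (ha.trans hv.1.1.le) hv.2, ENNReal.ofReal_zero]
  rw [h1, add_zero]
  refine setLIntegral_mono' (measurableSet_Ioc.inter F.measurableSet_support) fun v hv => ?_
  rw [← ENNReal.ofReal_mul (F.density_pos v hv.2).le, mul_comm]
  exact ENNReal.ofReal_le_ofReal (h v hv.2 hv.1)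

/-- A lower bound on the inverse hazard rate bounds the tail integral from below. -/
theorem le_integral_tail_of_le {a b c d : ℝ} (hab : a ≤ b)
    (h0 : ∀ v ∈ Ioc a b, 0 ≤ c + d * (v - a))
    (h : ∀ v ∈ F.support, v ∈ Ioo a b → (c + d * (v - a)) * F.density v ≤ F.tail v) :
    c * (F.tail a - F.tail b) + d * ((∫ u in a..b, F.tail u) - (b - a) * F.tail b) ≤
      ∫ u in a..b, F.tail u := by
  rw [← F.integral_Ioc_affine hab]
  refine (ENNReal.ofReal_le_ofReal_iff
    (intervalIntegral.integral_nonneg hab fun u _ => F.tail_nonneg u)).1 ?_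
  rw [F.integral_tail_eq_toReal hab, F.ofReal_integral_Ioc_affine h0,
    -- The bound may fail at `b` itself, which will be the monopoly price; the law has no atoms.
    setLIntegral_congr (Ioo_ae_eq_Ioc (μ := F.law)).symm,
    F.setLIntegral_law measurableSet_Ioo (by fun_prop)]
  refine le_trans ?_ (lintegral_mono_set (inter_subset_left.trans Ioo_subset_Ioc_self) :
    ∫⁻ v in Ioo a b ∩ F.support, ENNReal.ofReal (F.tail v) ≤ _)
  refine setLIntegral_mono' (measurableSet_Ioo.inter F.measurableSet_support) fun v hv => ?_
  rw [← ENNReal.ofReal_mul (F.density_pos v hv.2).le, mul_comm]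
  exact ENNReal.ofReal_le_ofReal (h v hv.2 hv.1)

/-- The integral of the affine bound contains `lam` times the tail integral again, which moves to
the left; the boundary terms at `b` have the right sign. The result is uniform in `b`. -/
theorem mul_integral_tail_le {a b lam : ℝ} (hlam : 0 ≤ lam) (ha0 : 0 ≤ a) (ha : F.lo ≤ a)
    (hab : a ≤ b)
    (h : ∀ v ∈ F.support, a < v → F.tail v ≤ (a + lam * (v - a)) * F.density v) :
    (1 - lam) * ∫ u in a..b, F.tail u ≤ a * F.tail a := by
  have h1 := F.integral_tail_le_of_le hab ha (c := a) (d := lam)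
    (fun v hv => add_nonneg ha0 (mul_nonneg hlam (by linarith [hv.1])))
    fun v hv hv' => h v hv hv'.1
  have h2 : 0 ≤ a * F.tail b := mul_nonneg ha0 (F.tail_nonneg b)
  have h3 : 0 ≤ lam * ((b - a) * F.tail b) :=
    mul_nonneg hlam (mul_nonneg (by linarith) (F.tail_nonneg b))
  linarith

theorem mul_tail_le {a r lam : ℝ} (hlam : 0 ≤ lam) (hlam1 : lam < 1) (ha0 : 0 ≤ a) (har : a ≤ r)
    (h : ∀ v ∈ F.support, v < r → (r + lam * (v - r)) * F.density v ≤ F.tail v) :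
    (r + lam * (a - r)) * F.tail a ≤ r * F.tail r + (1 - lam) * ∫ u in a..r, F.tail u := by
  have h1 := F.le_integral_tail_of_le har (c := r + lam * (a - r)) (d := lam)
    (fun v hv => by nlinarith [hv.1]) fun v hv hv' => by
      have := h v hv hv'.2
      rwa [show r + lam * (a - r) + lam * (v - a) = r + lam * (v - r) by ring]
  linarith

/-- The Gronwall argument below the monopoly price. -/
theorem gronwall_tail {r lam : ℝ} (hlam : 0 ≤ lam) (hlam1 : lam < 1) (hr : 0 < r)
    (h : ∀ v ∈ F.support, v < r → (r + lam * (v - r)) * F.density v ≤ F.tail v)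
    {Q : ℝ → ℝ} (hQ : ∀ v ∈ Icc 0 r, 0 ≤ Q v)
    (hQ' : ∀ v ∈ Icc 0 r, HasDerivAt Q ((1 - lam) * Q v / (r + lam * (v - r))) v) :
    (r * F.tail r + (1 - lam) * ∫ u in 0..r, F.tail u) * Q 0 ≤ r * F.tail r * Q r := by
  -- This function `K` dominates `(r + lam * (v - r)) * F.tail v` by `mul_tail_le`, so `K' ≥ -(1 -
  -- lam) * K / (r + lam * (v - r))`. `Q` is the integrating factor: `K * Q` is nondecreasing.
  have hK : ∀ v, HasDerivAt (fun v => r * F.tail r + (1 - lam) * ∫ u in v..r, F.tail u)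
      ((1 - lam) * (-F.tail v)) v := fun v =>
    ((intervalIntegral.integral_hasDerivAt_left (F.intervalIntegrable_tail v r)
      (F.continuous_tail.stronglyMeasurableAtFilter _ _)
      F.continuous_tail.continuousAt).const_mul _).const_add _
  have hw : ∀ v ∈ Icc 0 r, 0 < r + lam * (v - r) := fun v hv => by nlinarith [hv.1, hv.2]
  have hmono : MonotoneOn
      (fun v => (r * F.tail r + (1 - lam) * ∫ u in v..r, F.tail u) * Q v) (Icc 0 r) := by
    refine monotoneOn_of_hasDerivWithinAt_nonneg (convex_Icc 0 r)
      (f' := fun v => (1 - lam) * (-F.tail v) * Q v +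
        (r * F.tail r + (1 - lam) * ∫ u in v..r, F.tail u) *
          ((1 - lam) * Q v / (r + lam * (v - r))))
      (fun v hv => ((hK v).mul (hQ' v hv)).continuousAt.continuousWithinAt)
      (fun v hv => ((hK v).mul (hQ' v (interior_subset hv))).hasDerivWithinAt) fun v hv => ?_
    have hv := interior_subset hv
    have h1 := F.mul_tail_le hlam hlam1 hv.1 hv.2 h
    have h2 := hw v hv
    have : (1 - lam) * (-F.tail v) * Q v +
        (r * F.tail r + (1 - lam) * ∫ u in v..r, F.tail u) *
          ((1 - lam) * Q v / (r + lam * (v - r))) =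
        (1 - lam) * Q v / (r + lam * (v - r)) *
          (r * F.tail r + (1 - lam) * (∫ u in v..r, F.tail u) -
            (r + lam * (v - r)) * F.tail v) := by
      field_simp
      ring
    rw [this]
    exact mul_nonneg (div_nonneg (mul_nonneg (by linarith) (hQ v hv)) h2.le) (by linarith)
  have := hmono (left_mem_Icc.2 hr.le) (right_mem_Icc.2 hr.le) hr.le
  simpa using this

end ValueDistribution

/-! ### Estimates for the constant `regConst`. -/

theorem regConst_pos {lam : ℝ} (hlam1 : lam < 1) : 0 < regConst lam := by
  unfold regConst
  split_ifs
  · positivity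
  · exact Real.rpow_pos_of_pos (by linarith) _

theorem regConst_eq_mul_rpow {lam : ℝ} (h0 : lam ≠ 0) (hlam1 : lam < 1) :
    regConst lam = (1 - lam) * (1 - lam) ^ ((1 - lam) / lam) := by
  rw [regConst, if_neg h0, ← Real.rpow_one_add' (by linarith)]
  · congr 1
    field_simp
    ring
  · have : 1 + (1 - lam) / lam = 1 / lam := by field_simp; ring
    rw [this]
    positivity

/-- Needed at the market-clearing price. It follows from `1 - lam ≤ exp (-lam)` and `2 - lam ≤ exp
(1 - lam)`; at `lam = 0` it says `2 ≤ e`. -/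
theorem regConst_mul_le {lam : ℝ} (hlam0 : 0 ≤ lam) (hlam1 : lam < 1) :
    regConst lam * (2 - lam) ≤ 1 - lam := by
  rcases hlam0.eq_or_lt with rfl | hpos
  · have h1 := Real.add_one_le_exp (1 : ℝ)
    rw [regConst, if_pos rfl, one_div, inv_mul_le_iff₀ (Real.exp_pos 1)]
    linarith
  · rw [regConst_eq_mul_rpow hpos.ne' hlam1, mul_assoc]
    refine mul_le_of_le_one_right (by linarith) ?_
    have h1 : (1 - lam) ^ ((1 - lam) / lam) ≤ Real.exp (-(1 - lam)) := by
      calc (1 - lam) ^ ((1 - lam) / lam) ≤ Real.exp (-lam) ^ ((1 - lam) / lam) :=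
            Real.rpow_le_rpow (by linarith) (by linarith [Real.add_one_le_exp (-lam)])
              (div_nonneg (by linarith) hlam0)
        _ = Real.exp (-(1 - lam)) := by
            rw [← Real.exp_mul]
            congr 1
            field_simp
    calc _ ≤ Real.exp (-(1 - lam)) * Real.exp (1 - lam) := by
          refine mul_le_mul h1 ?_ (by linarith) (Real.exp_pos _).le
          linarith [Real.add_one_le_exp (1 - lam)]
      _ = 1 := by rw [← Real.exp_add]; simp

namespace ValueDistribution

variable (F : ValueDistribution)

/-- The mean is at most `1 / regConst lam` times the monopoly revenue. -/
theorem regConst_mul_integral_tail_le {r b lam : ℝ} (hlam : 0 ≤ lam) (hlam1 : lam < 1)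
    (hr0 : 0 ≤ r) (hr : F.lo ≤ r)
    (hlow : ∀ v ∈ F.support, v < r → (r + lam * (v - r)) * F.density v ≤ F.tail v)
    (hup : ∀ v ∈ F.support, r < v → F.tail v ≤ (r + lam * (v - r)) * F.density v)
    (hrb : r ≤ b) :
    regConst lam * ∫ u in 0..b, F.tail u ≤ r * F.tail r := by
  have h1 := F.mul_integral_tail_le hlam hr0 hr hrb hup
  have hc := regConst_pos hlam1
  have hsplit := intervalIntegral.integral_add_adjacent_intervals
    (F.intervalIntegrable_tail 0 r) (F.intervalIntegrable_tail r b)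
  -- By `h1` the part of the integral above `r`, times `1 - lam`, is at most `r * F.tail r`, so the
  -- bracket dominates `1 - lam` times the whole integral. The constant is `1 - lam` times the ratio
  -- `Q 0 / Q r` of integrating factors.
  have key : regConst lam * (r * F.tail r + (1 - lam) * ∫ u in 0..r, F.tail u) ≤
      (1 - lam) * (r * F.tail r) := by
    rcases hr0.eq_or_lt with rfl | hrpos
    · simp
    rcases hlam.eq_or_lt with rfl | hpos
    · have := F.gronwall_tail le_rfl hlam1 hrpos hlow (Q := fun v => Real.exp (v / r))
        (fun v _ => (Real.exp_pos _).le) fun v _ => by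
          have : HasDerivAt (fun v => Real.exp (v / r)) (Real.exp (v / r) * (1 / r)) v :=
            ((hasDerivAt_id v).div_const r).exp
          convert this using 1
          ring
      simp only [zero_div, Real.exp_zero, mul_one, div_self hrpos.ne'] at this
      rw [regConst, if_pos rfl, one_div, inv_mul_le_iff₀ (Real.exp_pos 1)]
      linarith
    · have hw : ∀ v ∈ Icc 0 r, 0 < r + lam * (v - r) := fun v hv => by nlinarith [hv.1, hv.2]
      have := F.gronwall_tail hlam hlam1 hrpos hlow
        (Q := fun v => (r + lam * (v - r)) ^ ((1 - lam) / lam))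
        (fun v hv => Real.rpow_nonneg (hw v hv).le _) fun v hv => by
          have h2 : HasDerivAt (fun v => r + lam * (v - r)) lam v := by
            simpa using (((hasDerivAt_id v).sub_const r).const_mul lam).const_add r
          have h3 := h2.rpow_const (p := (1 - lam) / lam) (Or.inl (hw v hv).ne')
          convert h3 using 1
          rw [Real.rpow_sub_one (hw v hv).ne']
          field_simp
      simp only [zero_sub, sub_self, mul_zero, add_zero] at this
      rw [show r + lam * -r = (1 - lam) * r by ring, Real.mul_rpow (by linarith) hr0,
        ← mul_assoc] at this
      have h4 := le_of_mul_le_mul_right this (Real.rpow_pos_of_pos hrpos _)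
      rw [regConst_eq_mul_rpow hpos.ne' hlam1]
      nlinarith
  have h5 : (1 - lam) * (regConst lam * ∫ u in 0..b, F.tail u) ≤ (1 - lam) * (r * F.tail r) := by
    rw [← hsplit]
    nlinarith
  exact le_of_mul_le_mul_left h5 (by linarith)

/-- A `lam`-regular distribution has a monopoly price, below which the inverse hazard rate is at
least, and above which it is at most, an affine function of slope `lam`. -/
theorem IsRegular.exists_monopoly_price {F : ValueDistribution} {lam : ℝ} (hF : F.IsRegular lam)
    (hlam1 : lam < 1) :
    ∃ r, F.lo ≤ r ∧
      (∀ v ∈ F.support, v < r → (r + lam * (v - r)) * F.density v ≤ F.tail v) ∧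
      (∀ v ∈ F.support, r < v → F.tail v ≤ (r + lam * (v - r)) * F.density v) := by
  set φ : ℝ → ℝ := fun v => lam * v - (1 - F.cdf v) / F.density v with hφ
  have hlo : F.lo ∈ F.support := ⟨le_rfl, F.lo_lt_hi.le⟩
  -- The inverse hazard rate is `lam * v - φ v`, and it equals `r + lam * (v - r)` exactly when `-φ
  -- v = (1 - lam) * r`. So `r` is where `(1 - lam) * v + φ v` changes sign. Including `F.lo` covers
  -- a function that is positive throughout; `φ` may jump, hence a supremum.
  set A : Set ℝ := {v | v = F.lo ∨ v ∈ F.support ∧ (1 - lam) * v + φ v ≤ 0} with hA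
  have hmono : MonotoneOn φ F.support := hF
  have hconn : ∀ u ∈ F.support, ∀ v, F.lo ≤ v → v ≤ u → v ∈ F.support := fun u hu v h1 h2 =>
    ⟨h1, le_trans (by exact_mod_cast h2) hu.2⟩
  have hne : A.Nonempty := ⟨F.lo, Or.inl rfl⟩
  have hbdd : BddAbove A := by
    refine ⟨max F.lo (-φ F.lo / (1 - lam)), fun v hv => ?_⟩
    rcases hv with rfl | ⟨hv, h⟩
    · exact le_max_left _ _
    · refine le_max_of_le_right ?_
      rw [le_div_iff₀ (by linarith)]
      linarith [hmono hlo hv hv.1]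
  have hφt : ∀ v ∈ F.support, F.tail v = (lam * v - φ v) * F.density v := fun v hv => by
    have := F.density_pos v hv
    rw [hφ, tail_eq_one_sub_cdf]
    field_simp
    ring
  refine ⟨sSup A, le_csSup hbdd (Or.inl rfl), fun v hv hvr => ?_, fun v hv hvr => ?_⟩
  · rw [hφt v hv]
    refine mul_le_mul_of_nonneg_right ?_ (F.density_pos v hv).le
    have h1 : sSup A ≤ -φ v / (1 - lam) := by
      obtain ⟨a, ha, hva⟩ := exists_lt_of_lt_csSup hne hvr
      have key : ∀ a ∈ A, v < a → a ≤ -φ v / (1 - lam) := by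
        intro a ha hva
        rcases ha with rfl | ⟨ha, h⟩
        · exact absurd hv.1 (not_le.2 hva)
        · rw [le_div_iff₀ (by linarith)]
          linarith [hmono hv ha hva.le]
      refine csSup_le hne fun a' ha' => ?_
      rcases le_or_gt a' v with h | h
      · exact h.trans (hva.le.trans (key a ha hva))
      · exact key a' ha' h
    rw [le_div_iff₀ (by linarith)] at h1
    linarith
  · rw [hφt v hv]
    refine mul_le_mul_of_nonneg_right ?_ (F.density_pos v hv).le
    have h1 : -φ v / (1 - lam) ≤ sSup A := by
      refine le_of_forall_gt_imp_ge_of_dense fun u hu => ?_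
      rw [div_le_iff₀ (by linarith)]
      have hlt : max (sSup A) F.lo < u := max_lt hu ((le_csSup hbdd (Or.inl rfl)).trans_lt hu)
      rcases le_or_gt u v with huv | huv
      · have hus := hconn v hv u (le_max_right _ _ |>.trans hlt.le) huv
        have : u ∉ A := fun h => not_lt.2 (le_csSup hbdd h) hu
        have : ¬ ((1 - lam) * u + φ u ≤ 0) := fun h => this (Or.inr ⟨hus, h⟩)
        linarith [hmono hus hv huv]
      · have : v ∉ A := fun h => not_lt.2 (le_csSup hbdd h) hvr
        have : ¬ ((1 - lam) * v + φ v ≤ 0) := fun h => this (Or.inr ⟨hv, h⟩)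
        nlinarith
    rw [div_le_iff₀ (by linarith)] at h1
    linarith

end ValueDistribution

end Intermediation

/-! ### Expected direct sales to the buyers at a posted price. -/

namespace Intermediation

open Set ProbabilityTheory

/-- The indicator, as a natural number, of the event that a valuation is at least `r`. -/
noncomputable def aboveIndicator (r v : ℝ) : ℕ := (Ici r).indicator (fun _ => 1) v

theorem measurable_aboveIndicator (r : ℝ) : Measurable (aboveIndicator r) :=
  measurable_const.indicator measurableSet_Ici

theorem numAbove_eq_sum {ι : Type} [Fintype ι] (r : ℝ) (t : ι → ℝ) :
    numAbove r t = ∑ i, aboveIndicator r (t i) := by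
  classical
  simp only [numAbove, aboveIndicator, indicator_apply, mem_Ici, Finset.card_filter]

theorem measurable_numAbove {ι : Type} [Fintype ι] (r : ℝ) :
    Measurable (numAbove r : (ι → ℝ) → ℕ) := by
  simp only [funext (numAbove_eq_sum r)]
  exact Finset.measurable_sum _ fun i _ =>
    (measurable_aboveIndicator r).comp (measurable_pi_apply i)

theorem integrable_nat_le {Ω : Type*} [MeasurableSpace Ω] {μ : Measure Ω} [IsFiniteMeasure μ]
    {X : Ω → ℕ} (hX : Measurable X) {k : ℕ} (hk : ∀ ω, X ω ≤ k) :
    Integrable (fun ω => (X ω : ℝ)) μ :=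
  Integrable.of_bound ((measurable_from_nat (f := fun n : ℕ => (n : ℝ))).comp hX).aestronglyMeasurable (k : ℝ)
    (ae_of_all _ fun ω => by simpa using hk ω)

theorem ValueDistribution.integral_aboveIndicator (F : ValueDistribution) {n : ℕ} (i : Fin n)
    (r : ℝ) :
    ∫ v, (aboveIndicator r (v i) : ℝ) ∂(Measure.pi fun _ : Fin n => F.law) = F.tail r := by
  have h1 : ∀ x : ℝ, (aboveIndicator r x : ℝ) = (Ici r).indicator (fun _ => (1 : ℝ)) x := fun x => by
    simp only [aboveIndicator, indicator_apply]
    split_ifs <;> simp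
  simp only [h1]
  have h2 := integral_map (μ := Measure.pi fun _ : Fin n => F.law)
    (measurable_pi_apply i).aemeasurable
    ((measurable_const (a := (1 : ℝ))).indicator
      (measurableSet_Ici (a := r))).aestronglyMeasurable
  have h3 : Measure.map (fun v : Fin n → ℝ => v i) (Measure.pi fun _ : Fin n => F.law) = F.law :=
    (measurePreserving_eval (fun _ : Fin n => F.law) i).map_eq
  rw [h3, integral_indicator measurableSet_Ici] at h2
  refine h2.symm.trans ?_
  simp [tail]

/-- One more buyer raises the expected number of sales when capped at `k`. -/
theorem ValueDistribution.integral_min_sum_insert (F : ValueDistribution) {n k : ℕ} (hk : 0 < k)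
    (r : ℝ) {s : Finset (Fin n)} {i : Fin n} (hi : i ∉ s) :
    (k : ℝ) - ∫ v, ((min k (∑ j ∈ insert i s, aboveIndicator r (v j)) : ℕ) : ℝ)
        ∂(Measure.pi fun _ : Fin n => F.law) ≤
      (k - ∫ v, ((min k (∑ j ∈ s, aboveIndicator r (v j)) : ℕ) : ℝ)
        ∂(Measure.pi fun _ : Fin n => F.law)) * (1 - F.tail r / k) := by
  set P := Measure.pi fun _ : Fin n => F.law
  set X : Fin n → (Fin n → ℝ) → ℕ := fun j v => aboveIndicator r (v j) with hX
  have hXm : ∀ j, Measurable (X j) := fun j =>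
    (measurable_aboveIndicator r).comp (measurable_pi_apply j)
  have hind : IndepFun (∑ j ∈ s, X j) (X i) P :=
    (iIndepFun_pi fun _ => (measurable_aboveIndicator r).aemeasurable).indepFun_finsetSum_of_notMem
      hXm hi
  have hNm : Measurable (∑ j ∈ s, X j) := by
    rw [show ∑ j ∈ s, X j = fun v => ∑ j ∈ s, X j v from funext fun v => Finset.sum_apply v s X]
    exact Finset.measurable_sum _ fun j _ => hXm j
  set g : ℕ → ℝ := fun N => 1 - (min k N : ℕ) / (k : ℝ)
  have hprod := (hind.comp (φ := g) (ψ := fun a : ℕ => (a : ℝ)) measurable_from_nat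
    measurable_from_nat).integral_fun_mul_eq_mul_integral
      (measurable_from_nat.comp hNm).aestronglyMeasurable
      (measurable_from_nat.comp (hXm i)).aestronglyMeasurable
  have hX1 : ∀ v, X i v ≤ 1 := fun v => by
    simp only [hX, aboveIndicator, indicator_apply]
    split_ifs <;> simp
  have hmint : ∀ {Y : (Fin n → ℝ) → ℕ}, Measurable Y →
      Integrable (fun v => ((min k (Y v) : ℕ) : ℝ)) P := fun hY =>
    integrable_nat_le (measurable_const.min hY) fun v => min_le_left _ _
  have hgi : ∫ v, (g ∘ ∑ j ∈ s, X j) v ∂P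
      = 1 - (∫ v, ((min k (∑ j ∈ s, X j v) : ℕ) : ℝ) ∂P) / k := by
    have := integral_sub (μ := P) (integrable_const (1 : ℝ)) ((hmint hNm).div_const (k : ℝ))
    rw [integral_div] at this
    simpa [g] using this
  have hXi : ∫ v, ((fun a : ℕ => (a : ℝ)) ∘ X i) v ∂P = F.tail r := F.integral_aboveIndicator i r
  rw [hgi, hXi] at hprod
  -- Pathwise, for `x` in `{0, 1}`, `min k (N + x) ≥ min k N + (1 - min k N / k) * x`. By
  -- independence the expected shortfall from `k` then shrinks by the factor `1 - F.tail r / k`.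
  have hle : ∫ v, ((min k (∑ j ∈ s, X j v) : ℕ) : ℝ) ∂P +
      ∫ v, (g ∘ ∑ j ∈ s, X j) v * ((fun a : ℕ => (a : ℝ)) ∘ X i) v ∂P ≤
      ∫ v, ((min k (∑ j ∈ insert i s, X j v) : ℕ) : ℝ) ∂P := by
    have hI1 : Integrable (fun v => ((min k (∑ j ∈ s, X j v) : ℕ) : ℝ)) P := by
      simpa using hmint hNm
    have hI2 : Integrable (fun v => (g ∘ ∑ j ∈ s, X j) v * ((fun a : ℕ => (a : ℝ)) ∘ X i) v) P := by
      refine Integrable.of_bound ((measurable_from_nat.comp hNm).mul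
        (measurable_from_nat.comp (hXm i))).aestronglyMeasurable 1 (ae_of_all _ fun v => ?_)
      have h1 : ((min k ((∑ j ∈ s, X j) v) : ℕ) : ℝ) / k ≤ 1 := by
        rw [div_le_one (by exact_mod_cast hk)]
        exact_mod_cast min_le_left _ _
      have h2 : 0 ≤ ((min k ((∑ j ∈ s, X j) v) : ℕ) : ℝ) / k := by positivity
      have h3 : ((X i v : ℕ) : ℝ) ≤ 1 := by exact_mod_cast hX1 v
      simp only [Function.comp, g]
      rw [Real.norm_of_nonneg (mul_nonneg (by linarith) (by positivity))]
      exact mul_le_one₀ (by linarith) (by positivity) h3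
    rw [← integral_add hI1 hI2]
    refine integral_mono (hI1.add hI2) (integrable_nat_le (k := k)
      (measurable_const.min (Finset.measurable_sum _ fun j _ => hXm j)) fun v => min_le_left _ _)
      fun v => ?_
    simp only [Function.comp, g, Finset.sum_insert hi, Finset.sum_apply]
    have hx := hX1 v
    set N := ∑ j ∈ s, X j v
    have hk' : (0 : ℝ) < k := by exact_mod_cast hk
    interval_cases hx' : X i v
    · simp
    · rcases le_or_gt k N with h | h
      · rw [min_eq_left h, min_eq_left (by omega)]
        simp [hk'.ne']
      · rw [min_eq_right h.le, min_eq_right (by omega)]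
        have : 0 ≤ (N : ℝ) / k := by positivity
        push_cast
        linarith
  rw [hprod] at hle
  have e : (k - ∫ v, ((min k (∑ j ∈ s, X j v) : ℕ) : ℝ) ∂P) * (1 - F.tail r / k) =
      k - ∫ v, ((min k (∑ j ∈ s, X j v) : ℕ) : ℝ) ∂P -
        (1 - (∫ v, ((min k (∑ j ∈ s, X j v) : ℕ) : ℝ) ∂P) / k) * F.tail r := by
    have hk' : (k : ℝ) ≠ 0 := by exact_mod_cast hk.ne'
    field_simp
  change (k : ℝ) - ∫ v, ((min k (∑ j ∈ insert i s, X j v) : ℕ) : ℝ) ∂P ≤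
    (k - ∫ v, ((min k (∑ j ∈ s, X j v) : ℕ) : ℝ) ∂P) * (1 - F.tail r / k)
  rw [e]
  linarith

theorem one_sub_exp_mul_le {x : ℝ} (hx0 : 0 ≤ x) (hx1 : x ≤ 1) :
    (1 - 1 / Real.exp 1) * x ≤ 1 - Real.exp (-x) := by
  -- On `[-1, 0]` the exponential lies below its chord.
  have := convexOn_exp.2 (mem_univ (0 : ℝ)) (mem_univ (-1 : ℝ)) (sub_nonneg.2 hx1) hx0
    (sub_add_cancel 1 x)
  simp only [smul_eq_mul, mul_zero, zero_add, Real.exp_zero, mul_one, mul_neg, Real.exp_neg] at this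
  rw [Real.exp_neg, one_div]
  linarith

/-- The expected number of sales at a price at which expected demand does not exceed supply. -/
theorem ValueDistribution.le_integral_min_numAbove (F : ValueDistribution) {n k : ℕ} (hk : 0 < k)
    {r : ℝ} (h : n * F.tail r ≤ k) :
    (1 - 1 / Real.exp 1) * (n * F.tail r) ≤
      ∫ v, ((min k (numAbove r v) : ℕ) : ℝ) ∂(Measure.pi fun _ : Fin n => F.law) := by
  have hk' : (0 : ℝ) < k := by exact_mod_cast hk
  simp only [numAbove_eq_sum]
  have hq := F.tail_le_one r
  have hk1 : (1 : ℝ) ≤ k := by exact_mod_cast hk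
  have hq0 : 0 ≤ 1 - F.tail r / k := by
    rw [sub_nonneg, div_le_one hk']
    linarith
  have hpow : ∀ s : Finset (Fin n), (k : ℝ) - ∫ v, ((min k (∑ j ∈ s, aboveIndicator r (v j)) : ℕ) : ℝ)
      ∂(Measure.pi fun _ : Fin n => F.law) ≤ k * (1 - F.tail r / k) ^ s.card := by
    intro s
    induction s using Finset.induction_on with
    | empty => simp
    | insert i s hi ih =>
      rw [Finset.card_insert_of_notMem hi, pow_succ, ← mul_assoc]
      exact (F.integral_min_sum_insert hk r hi).trans (mul_le_mul_of_nonneg_right ih hq0)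
  have h1 := hpow Finset.univ
  rw [Finset.card_univ, Fintype.card_fin] at h1
  have h2 : (1 - F.tail r / k) ^ n ≤ Real.exp (-(n * F.tail r / k)) := by
    calc _ ≤ Real.exp (-(F.tail r / k)) ^ n :=
          pow_le_pow_left₀ hq0 (by linarith [Real.add_one_le_exp (-(F.tail r / k))]) n
      _ = _ := by
          rw [← Real.exp_nat_mul]
          congr 1
          ring
  have h3 := one_sub_exp_mul_le (x := n * F.tail r / k)
    (div_nonneg (mul_nonneg (by positivity) (F.tail_nonneg r)) hk'.le) ((div_le_one hk').2 h)
  have h4 : (1 - 1 / Real.exp 1) * (n * F.tail r) =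
      k * ((1 - 1 / Real.exp 1) * (n * F.tail r / k)) := by
    field_simp
  rw [h4]
  have h5 := mul_le_mul_of_nonneg_left h2 hk'.le
  have h6 := mul_le_mul_of_nonneg_left h3 hk'.le
  linarith

end Intermediation

namespace Intermediation

open Set

/-! ### Demand at a uniform price. -/

section Demand

variable {ι : Type} {u : ℕ → ℝ → (ι → ℝ) → ℝ}

theorem demand_le (q : ℕ) (r : ℝ) (t : ι → ℝ) : demand u q r t ≤ q := Nat.findGreatest_le q

theorem le_demand (q : ℕ) (r : ℝ) (t : ι → ℝ) {y : ℕ} (hy : y ≤ q) :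
    u y (r * y) t ≤ u (demand u q r t) (r * demand u q r t) t := by
  classical
  obtain ⟨x, hx, hmax⟩ := Finset.exists_max_image (Finset.range (q + 1))
    (fun x : ℕ => u x (r * x) t) ⟨0, by simp⟩
  have := Nat.findGreatest_spec (P := fun x : ℕ => ∀ y ≤ q, u y (r * y) t ≤ u x (r * x) t)
    (Nat.lt_succ_iff.1 (Finset.mem_range.1 hx))
    (fun y hy => hmax y (Finset.mem_range.2 (Nat.lt_succ_of_le hy)))
  unfold demand
  convert this y hy

theorem measurable_demand {k q : ℕ} (hq : q ≤ k)
    (hu : ∀ x ≤ k, Measurable fun y : ℝ × (ι → ℝ) => u x y.1 y.2) (r : ℝ) :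
    Measurable (demand u q r) := by
  classical
  have hm : ∀ x ≤ k, Measurable fun t : ι → ℝ => u x (r * x) t := fun x hx =>
    (hu x hx).comp (measurable_const.prodMk measurable_id)
  unfold demand
  refine measurable_findGreatest fun x hx => ?_
  have : {t : ι → ℝ | ∀ y ≤ q, u y (r * y) t ≤ u x (r * x) t} =
      ⋂ y, ⋂ (_ : y ≤ q), {t | u y (r * y) t ≤ u x (r * x) t} := by
    ext t; simp
  rw [this]
  exact MeasurableSet.iInter fun y => MeasurableSet.iInter fun hy =>
    measurableSet_le (hm y (hy.trans hq)) (hm x (hx.trans hq))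

end Demand

/-! ### The sequential posted-price mechanism and its revenue. -/

section PostedPrice

variable {n k : ℕ} {F : ValueDistribution} {D : DemandStructure n}
  {U : (l : Fin D.m) → ℕ → ℝ → (D.Buyers l → ℝ) → ℝ} {τ : Fin D.m → ℝ}

/-- The valuations of the buyers of `l`. -/
def DemandStructure.block (D : DemandStructure n) (l : Fin D.m) (v : Fin n → ℝ) :
    D.Buyers l → ℝ := fun i => v i.1

theorem DemandStructure.measurable_block (l : Fin D.m) : Measurable (D.block l) :=
  measurable_pi_lambda _ fun i => measurable_pi_apply i.1

theorem DemandStructure.block_combine (l : Fin D.m) (t : D.Buyers l → ℝ) (w : Fin n → ℝ) :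
    D.block l (D.combine l t w) = t := by
  funext i
  simp [block, combine, i.2]

/-- The number of items sold to the first `j` intermediaries when they are offered, one after the
other, the remaining items at the uniform price `r`. -/
noncomputable def sold (U : (l : Fin D.m) → ℕ → ℝ → (D.Buyers l → ℝ) → ℝ) (k : ℕ) (r : ℝ)
    (v : Fin n → ℝ) : ℕ → ℕ
  | 0 => 0
  | j + 1 => sold U k r v j +
      if h : j < D.m then demand (U ⟨j, h⟩) (k - sold U k r v j) r (D.block ⟨j, h⟩ v) else 0

/-- The number of items that `l` purchases in the sequential sale at the uniform price `r`. -/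
noncomputable def purchase (U : (l : Fin D.m) → ℕ → ℝ → (D.Buyers l → ℝ) → ℝ) (k : ℕ) (r : ℝ)
    (v : Fin n → ℝ) (l : Fin D.m) : ℕ :=
  demand (U l) (k - sold U k r v l) r (D.block l v)

theorem sold_succ (r : ℝ) (v : Fin n → ℝ) (l : Fin D.m) :
    sold U k r v (l + 1) = sold U k r v l + purchase U k r v l := by
  simp [sold, purchase]

theorem sold_le (r : ℝ) (v : Fin n → ℝ) (j : ℕ) : sold U k r v j ≤ k := by
  induction j with
  | zero => simp [sold]
  | succ j ih =>
    rw [sold]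
    split_ifs with h
    · have := demand_le (u := U ⟨j, h⟩) (k - sold U k r v j) r (D.block ⟨j, h⟩ v)
      omega
    · simpa using ih

theorem monotone_sold (r : ℝ) (v : Fin n → ℝ) : Monotone (sold U k r v) :=
  monotone_nat_of_le_succ fun j => by rw [sold]; exact Nat.le_add_right _ _

theorem sum_purchase (r : ℝ) (v : Fin n → ℝ) :
    ∑ l, purchase U k r v l = sold U k r v D.m := by
  have : ∀ j, (hj : j ≤ D.m) →
      ∑ l : Fin j, purchase U k r v (l.castLE hj) = sold U k r v j := by
    intro j
    induction j with
    | zero => simp [sold]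
    | succ j ih =>
      intro hj
      have h1 := sold_succ (U := U) (k := k) r v ⟨j, hj⟩
      rw [Fin.sum_univ_castSucc]
      simp only [] at h1
      rw [h1, ← ih (Nat.le_of_succ_le hj)]
      rfl
  exact this D.m le_rfl

theorem sold_congr (r : ℝ) {v v' : Fin n → ℝ} {j : ℕ}
    (h : ∀ i, (D.rep i : ℕ) < j → v i = v' i) : sold U k r v j = sold U k r v' j := by
  induction j with
  | zero => simp [sold]
  | succ j ih =>
    rw [sold, sold, ih fun i hi => h i (Nat.lt_succ_of_lt hi)]
    congr 1
    split_ifs with hj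
    · have : D.block ⟨j, hj⟩ v = D.block ⟨j, hj⟩ v' := by
        funext i
        refine h i.1 ?_
        rw [i.2]
        exact Nat.lt_succ_self j
      rw [this]
    · rfl

/-- Sales before the turn of `l` depend only on earlier blocks. Both incentive compatibility and the
conditioning in `le_integral_purchase` rest on this. -/
theorem sold_combine (r : ℝ) (l : Fin D.m) (t : D.Buyers l → ℝ) (w : Fin n → ℝ) :
    sold U k r (D.combine l t w) l = sold U k r w l := by
  refine sold_congr r fun i hi => ?_
  have : D.rep i ≠ l := fun h => by simp [h] at hi
  simp [DemandStructure.combine, this]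

theorem purchase_combine (r : ℝ) (l : Fin D.m) (t : D.Buyers l → ℝ) (w : Fin n → ℝ) :
    purchase U k r (D.combine l t w) l = demand (U l) (k - sold U k r w l) r t := by
  rw [purchase, sold_combine, DemandStructure.block_combine]

theorem measurable_apply_nat {Ω ι γ : Type*} [MeasurableSpace Ω] [MeasurableSpace ι]
    [MeasurableSpace γ] {Q : Ω → ℕ} (hQ : Measurable Q) {B : Ω → ι} (hB : Measurable B)
    {g : ℕ → ι → γ}
    (hg : ∀ q, Measurable (g q)) : Measurable fun ω => g (Q ω) (B ω) :=
  (measurable_from_prod_countable_right (f := fun p : ℕ × ι => g p.1 p.2) hg).comp (hQ.prodMk hB)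

theorem measurable_sold (hU : Admissible F k D U τ) (r : ℝ) (j : ℕ) :
    Measurable fun v => sold U k r v j := by
  induction j with
  | zero => simp [sold]
  | succ j ih =>
    simp only [sold]
    refine ih.add ?_
    split_ifs with h
    · exact measurable_apply_nat ih (D.measurable_block ⟨j, h⟩)
        (g := fun s => demand (U ⟨j, h⟩) (k - s) r)
        fun s => measurable_demand (Nat.sub_le k s) (hU.measurable ⟨j, h⟩) r
    · exact measurable_const

theorem measurable_purchase (hU : Admissible F k D U τ) (r : ℝ) (l : Fin D.m) :
    Measurable fun v => purchase U k r v l :=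
  measurable_apply_nat (measurable_sold hU r l) (D.measurable_block l)
    (g := fun s => demand (U l) (k - s) r)
    fun s => measurable_demand (Nat.sub_le k s) (hU.measurable l) r

theorem purchase_le (r : ℝ) (v : Fin n → ℝ) (l : Fin D.m) : purchase U k r v l ≤ k :=
  (demand_le _ _ _).trans (Nat.sub_le _ _)

/-- The allocation of items in the sequential sale at the uniform price `r`. -/
noncomputable def purchases (U : (l : Fin D.m) → ℕ → ℝ → (D.Buyers l → ℝ) → ℝ) (k : ℕ) (r : ℝ)
    (v : Fin n → ℝ) (l : Fin D.m) : Fin (k + 1) :=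
  ⟨purchase U k r v l, Nat.lt_succ_of_le (purchase_le r v l)⟩

theorem measurable_purchases (hU : Admissible F k D U τ) (r : ℝ) :
    Measurable (purchases U k r) := by
  refine measurable_pi_lambda _ fun l => measurable_to_countable' fun x => ?_
  have : (fun v => purchases U k r v l) ⁻¹' {x} = (fun v => purchase U k r v l) ⁻¹' {(x : ℕ)} := by
    ext v
    simp [purchases, Fin.ext_iff]
  rw [this]
  exact measurable_purchase hU r l (measurableSet_singleton _)

open Classical in
/-- The sequential sale at the uniform price `r`, as a direct mechanism. -/
noncomputable def postedPrice (hU : Admissible F k D U τ) {r : ℝ} (hr : 0 ≤ r) :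
    Mechanism F k D where
  alloc v := Pi.single (purchases U k r v) 1
  pay l v := r * purchase U k r v l
  alloc_mem v := single_mem_stdSimplex ℝ _
  measurable_alloc a := by
    have : (fun v => (Pi.single (purchases U k r v) 1 : (Fin D.m → Fin (k + 1)) → ℝ) a) =
        (purchases U k r ⁻¹' {a}).indicator fun _ => 1 := by
      funext v
      simp only [Pi.single_apply, indicator_apply, mem_preimage, mem_singleton_iff, eq_comm]
    rw [this]
    exact measurable_const.indicator (measurable_purchases hU r (measurableSet_singleton a))
  pay_nonneg l v := by positivity
  measurable_pay l := measurable_const.mul (measurable_from_nat.comp (measurable_purchase hU r l))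
  feasible := ae_of_all _ fun v a ha => by
    have : a = purchases U k r v := by
      by_contra h
      exact ha (Pi.single_eq_of_ne h _)
    rw [this]
    exact (sum_purchase (U := U) (k := k) r v).trans_le (sold_le r v D.m)

theorem postedPrice_utility (hU : Admissible F k D U τ) {r : ℝ} (hr : 0 ≤ r) (l : Fin D.m)
    (s t : D.Buyers l → ℝ) (w : Fin n → ℝ) :
    (postedPrice hU hr).utility U l s t w =
      U l (demand (U l) (k - sold U k r w l) r s)
        (r * demand (U l) (k - sold U k r w l) r s) t := by
  classical
  rw [Mechanism.utility, Finset.sum_eq_single (purchases U k r (D.combine l s w))]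
  · simp [postedPrice, purchases, purchase_combine]
  · intro a _ ha
    simp [postedPrice, Pi.single_eq_of_ne ha]
  · simp

theorem postedPrice_isBIC (hU : Admissible F k D U τ) {r : ℝ} (hr : 0 ≤ r) :
    (postedPrice hU hr).IsBIC U := by
  intro l t ht
  have hint : Integrable ((postedPrice hU hr).utility U l t t)
      (Measure.pi fun _ : Fin n => F.law) := by
    simp only [funext (postedPrice_utility hU hr l t t)]
    set g : ℕ → ℝ := fun s => U l (demand (U l) (k - s) r t) (r * demand (U l) (k - s) r t) t
    refine Integrable.of_bound (f := fun w => g (sold U k r w l))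
      ((measurable_from_nat (f := g)).comp (measurable_sold hU r l)).aestronglyMeasurable
      (∑ s ∈ Finset.range (k + 1), ‖g s‖) (ae_of_all _ fun w => ?_)
    exact Finset.single_le_sum (f := fun s => ‖g s‖) (fun _ _ => norm_nonneg _)
      (Finset.mem_range.2 (Nat.lt_succ_of_le (sold_le r w l)))
  -- Both constraints hold for each fixed `w`: buying nothing and buying the misreported demand are
  -- feasible quantities, and truthful demand maximizes over all of them.
  refine ⟨hint, integral_nonneg fun w => ?_, fun s _ hs => integral_mono hs hint fun w => ?_⟩
  · simp only [postedPrice_utility, Pi.zero_apply]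
    have := le_demand (u := U l) (k - sold U k r w l) r t (Nat.zero_le _)
    simpa [hU.opt_out l t ht] using this
  · simp only [postedPrice_utility]
    exact le_demand _ r t (demand_le _ _ _)

theorem postedPrice_revenue (hU : Admissible F k D U τ) {r : ℝ} (hr : 0 ≤ r) :
    (postedPrice hU hr).revenue = ENNReal.ofReal
      (r * ∫ v, (sold U k r v D.m : ℝ) ∂(Measure.pi fun _ : Fin n => F.law)) := by
  have h : ∀ v, ∑ l, (postedPrice hU hr).pay l v = r * (sold U k r v D.m : ℝ) := fun v => by
    rw [← sum_purchase, Nat.cast_sum, Finset.mul_sum]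
    rfl
  rw [Mechanism.revenue, ← integral_const_mul, ofReal_integral_eq_lintegral_ofReal]
  · simp only [h]
  · exact (integrable_nat_le (measurable_sold hU r D.m) (sold_le r · D.m)).const_mul r
  · exact ae_of_all _ fun v => by positivity

/-- An inequality between expectations over the valuations in one block carries over to a
parameter which is determined by the valuations outside of the block. -/
theorem DemandStructure.integral_block_mono (D : DemandStructure n) (F : ValueDistribution)
    (l : Fin D.m) {Q : (Fin n → ℝ) → ℕ} (hQ : Measurable Q)
    (hQl : ∀ t w, Q (D.combine l t w) = Q w) {g h : ℕ → (D.Buyers l → ℝ) → ℝ} {C : ℝ}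
    (hg : ∀ q, Measurable (g q)) (hh : ∀ q, Measurable (h q))
    (hgC : ∀ q t, ‖g q t‖ ≤ C) (hhC : ∀ q t, ‖h q t‖ ≤ C)
    (hgh : ∀ q, ∫ t, g q t ∂(Measure.pi fun _ : D.Buyers l => F.law) ≤
      ∫ t, h q t ∂(Measure.pi fun _ : D.Buyers l => F.law)) :
    ∫ v, g (Q v) (D.block l v) ∂(Measure.pi fun _ : Fin n => F.law) ≤
      ∫ v, h (Q v) (D.block l v) ∂(Measure.pi fun _ : Fin n => F.law) := by
  set e := MeasurableEquiv.piEquivPiSubtypeProd (fun _ : Fin n => ℝ) (fun i => D.rep i = l)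
  have he : MeasurePreserving e.symm _ _ :=
    (measurePreserving_piEquivPiSubtypeProd (fun _ : Fin n => F.law) fun i => D.rep i = l).symm
  -- The filler `0` in the block is immaterial, since `Q` ignores these coordinates. Hence `Q` is
  -- constant in the inner Fubini integral.
  have hes : ∀ t w', e.symm (t, w') = D.combine l t (e.symm (0, w')) := by
    intro t w'
    funext i
    by_cases hi : D.rep i = l <;>
      simp [e, DemandStructure.combine, hi, MeasurableEquiv.piEquivPiSubtypeProd,
        Equiv.piEquivPiSubtypeProd]
  have key : ∀ f : ℕ → (D.Buyers l → ℝ) → ℝ, (∀ q, Measurable (f q)) → (∀ q t, ‖f q t‖ ≤ C) →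
      Integrable (fun w' => ∫ t, f (Q (e.symm (0, w'))) t
        ∂(Measure.pi fun _ : D.Buyers l => F.law))
        (Measure.pi fun _ : {i // ¬ D.rep i = l} => F.law) ∧
      ∫ v, f (Q v) (D.block l v) ∂(Measure.pi fun _ : Fin n => F.law) =
        ∫ w', ∫ t, f (Q (e.symm (0, w'))) t ∂(Measure.pi fun _ : D.Buyers l => F.law)
          ∂(Measure.pi fun _ : {i // ¬ D.rep i = l} => F.law) := by
    intro f hf hfC
    have hm : Measurable fun v => f (Q v) (D.block l v) :=
      measurable_apply_nat hQ (D.measurable_block l) hf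
    have hi : Integrable (fun v => f (Q v) (D.block l v)) (Measure.pi fun _ : Fin n => F.law) :=
      Integrable.of_bound hm.aestronglyMeasurable C (ae_of_all _ fun v => hfC _ _)
    have hi2 := he.integrable_comp_of_integrable hi
    have heq : ∀ p, ((fun v => f (Q v) (D.block l v)) ∘ e.symm) p = f (Q (e.symm (0, p.2))) p.1 := by
      rintro ⟨t, w'⟩
      simp only [Function.comp]
      rw [hes t w', hQl, D.block_combine]
    rw [funext heq] at hi2
    refine ⟨hi2.integral_prod_right, ?_⟩
    rw [← he.integral_comp' (g := fun v => f (Q v) (D.block l v))]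
    have := funext heq
    simp only [Function.comp_def] at this
    rw [this]
    exact integral_prod_symm _ hi2
  obtain ⟨hg1, hg2⟩ := key g hg hgC
  obtain ⟨hh1, hh2⟩ := key h hh hhC
  rw [hg2, hh2]
  exact integral_mono hg1 hh1 fun w' => hgh _

theorem le_integral_purchase (hU : Admissible F k D U τ) {r : ℝ} (hr : 0 ≤ r) (l : Fin D.m) :
    τ l * ∫ v, ((min (k - sold U k r v l) (numAbove r (D.block l v)) : ℕ) : ℝ)
        ∂(Measure.pi fun _ : Fin n => F.law) ≤
      ∫ v, (purchase U k r v l : ℝ) ∂(Measure.pi fun _ : Fin n => F.law) := by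
  have hτ := hU.tau_mem l
  rw [← integral_const_mul]
  refine D.integral_block_mono F l (measurable_sold hU r l) (sold_combine r l)
    (g := fun s t => τ l * ((min (k - s) (numAbove r t) : ℕ) : ℝ))
    (h := fun s t => (demand (U l) (k - s) r t : ℝ)) (C := k)
    (fun s => measurable_const.mul (measurable_from_nat.comp
      (measurable_const.min (measurable_numAbove r))))
    (fun s => measurable_from_nat.comp
      (measurable_demand (Nat.sub_le k s) (hU.measurable l) r)) ?_ ?_ ?_
  · intro s t
    have : ((min (k - s) (numAbove r t) : ℕ) : ℝ) ≤ k := by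
      exact_mod_cast (min_le_left _ _).trans (Nat.sub_le k s)
    rw [Real.norm_of_nonneg (mul_nonneg hτ.1.le (by positivity))]
    exact (mul_le_of_le_one_left (by positivity) hτ.2).trans this
  · intro s t
    rw [Real.norm_of_nonneg (by positivity)]
    exact_mod_cast (demand_le _ _ _).trans (Nat.sub_le k s)
  · intro s
    rw [integral_const_mul]
    exact hU.disconnectable l (k - s) (Nat.sub_le k s) r hr

theorem sum_numAbove_block (r : ℝ) (v : Fin n → ℝ) :
    ∑ l, numAbove r (D.block l v) = numAbove r v := by
  simp only [numAbove_eq_sum]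
  exact Fintype.sum_fiberwise D.rep fun i => aboveIndicator r (v i)

/-- Sales only reduce the remaining supply, so each block meets at least the final leftover; capping
at that leftover is subadditive over blocks. The items sold make up the rest. -/
theorem min_numAbove_le (r : ℝ) (v : Fin n → ℝ) :
    min k (numAbove r v) ≤
      ∑ l : Fin D.m, min (k - sold U k r v l) (numAbove r (D.block l v)) + sold U k r v D.m := by
  have h1 : ∑ l : Fin D.m, min (k - sold U k r v D.m) (numAbove r (D.block l v)) ≤
      ∑ l : Fin D.m, min (k - sold U k r v l) (numAbove r (D.block l v)) :=
    Finset.sum_le_sum fun l _ => min_le_min_right _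
      (Nat.sub_le_sub_left (monotone_sold r v l.2.le) k)
  have h2 : min (k - sold U k r v D.m) (numAbove r v) ≤
      ∑ l : Fin D.m, min (k - sold U k r v D.m) (numAbove r (D.block l v)) := by
    by_cases h : ∃ l : Fin D.m, k - sold U k r v D.m ≤ numAbove r (D.block l v)
    · obtain ⟨l, hl⟩ := h
      refine (min_le_left _ _).trans ((le_min le_rfl hl).trans ?_)
      exact Finset.single_le_sum
        (f := fun l : Fin D.m => min (k - sold U k r v D.m) (numAbove r (D.block l v)))
        (fun _ _ => Nat.zero_le _) (Finset.mem_univ l)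
    · push Not at h
      refine (min_le_right _ _).trans ?_
      rw [← sum_numAbove_block (D := D)]
      exact Finset.sum_le_sum fun l _ => le_min (h l).le le_rfl
  omega

/-- The expected number of items sold at a uniform price is at least `τ / 2` times the number of
items that would be sold directly to the buyers. -/
theorem le_integral_sold (hU : Admissible F k D U τ) {r : ℝ} (hr : 0 ≤ r) {a : ℝ} (ha0 : 0 ≤ a)
    (ha1 : a ≤ 1) (ha : ∀ l, a ≤ τ l) :
    a / 2 * ∫ v, ((min k (numAbove r v) : ℕ) : ℝ) ∂(Measure.pi fun _ : Fin n => F.law) ≤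
      ∫ v, (sold U k r v D.m : ℝ) ∂(Measure.pi fun _ : Fin n => F.law) := by
  set P := Measure.pi fun _ : Fin n => F.law
  have hS : Integrable (fun v => (sold U k r v D.m : ℝ)) P :=
    integrable_nat_le (measurable_sold hU r D.m) (sold_le r · D.m)
  have hl : ∀ l : Fin D.m, Integrable (fun v =>
      ((min (k - sold U k r v l) (numAbove r (D.block l v)) : ℕ) : ℝ)) P := fun l =>
    integrable_nat_le (k := k) (((measurable_from_nat (f := fun s => k - s)).comp
      (measurable_sold hU r l)).min ((measurable_numAbove r).comp (D.measurable_block l)))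
      fun v => (min_le_left _ _).trans (Nat.sub_le _ _)
  have hp : ∀ l, Integrable (fun v => (purchase U k r v l : ℝ)) P := fun l =>
    integrable_nat_le (measurable_purchase hU r l) (purchase_le r · l)
  have h1 : ∫ v, ((min k (numAbove r v) : ℕ) : ℝ) ∂P ≤
      ∑ l : Fin D.m, ∫ v, ((min (k - sold U k r v l) (numAbove r (D.block l v)) : ℕ) : ℝ) ∂P +
        ∫ v, (sold U k r v D.m : ℝ) ∂P := by
    rw [← integral_finsetSum _ fun l _ => hl l,
      ← integral_add (integrable_finsetSum _ fun l _ => hl l) hS]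
    refine integral_mono (integrable_nat_le (measurable_const.min (measurable_numAbove r))
      fun v => min_le_left _ _) ((integrable_finsetSum _ fun l _ => hl l).add hS) fun v => ?_
    simp only []
    exact_mod_cast min_numAbove_le (U := U) r v
  have h2 : ∫ v, (sold U k r v D.m : ℝ) ∂P = ∑ l, ∫ v, (purchase U k r v l : ℝ) ∂P := by
    rw [← integral_finsetSum _ fun l _ => hp l]
    simp only [← sum_purchase, Nat.cast_sum]
  have h3 : a * ∑ l : Fin D.m, ∫ v, ((min (k - sold U k r v l) (numAbove r (D.block l v)) : ℕ) : ℝ) ∂P ≤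
      ∫ v, (sold U k r v D.m : ℝ) ∂P := by
    rw [h2, Finset.mul_sum]
    exact Finset.sum_le_sum fun l _ => (mul_le_mul_of_nonneg_right (ha l)
      (integral_nonneg fun v => by positivity)).trans (le_integral_purchase hU hr l)
  have h4 : 0 ≤ ∫ v, (sold U k r v D.m : ℝ) ∂P := integral_nonneg fun v => by positivity
  have h5 := mul_le_mul_of_nonneg_left h1 ha0
  -- With `S` the expected sales, `a` times the expected direct sales is at most `S + a * S ≤ 2 *
  -- S`.
  nlinarith [mul_nonneg (sub_nonneg.2 ha1) h4]

/-- A posted price bounds the optimal revenue from below. -/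
theorem le_optimalRevenue (hU : Admissible F k D U τ) {r : ℝ} (hr : 0 ≤ r) {a : ℝ} (ha0 : 0 ≤ a)
    (ha1 : a ≤ 1) (ha : ∀ l, a ≤ τ l) :
    ENNReal.ofReal (r * (a / 2 *
      ∫ v, ((min k (numAbove r v) : ℕ) : ℝ) ∂(Measure.pi fun _ : Fin n => F.law))) ≤
      optimalRevenue F k D U := by
  refine le_trans ?_ (le_iSup₂_of_le (postedPrice hU hr) (postedPrice_isBIC hU hr) le_rfl)
  rw [postedPrice_revenue]
  exact ENNReal.ofReal_le_ofReal (mul_le_mul_of_nonneg_left (le_integral_sold hU hr ha0 ha1 ha) hr)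

end PostedPrice

end Intermediation

/-! ### Welfare upper bound and choice of the price. -/

namespace Intermediation

open Set

/-- Weak duality with `p` as the shadow price of an item. Positions beyond `n` contribute `0 ≤ p`.
-/
theorem sum_orderStat_le {n : ℕ} (k : ℕ) (v : Fin n → ℝ) {p : ℝ} (hp : 0 ≤ p) :
    ∑ j ∈ Finset.range k, orderStat v j ≤ k * p + ∑ i, max 0 (v i - p) := by
  set g : ℕ → ℝ := fun j =>
    if h : j < n then max 0 (v (Tuple.sort v (Fin.rev ⟨j, h⟩)) - p) else 0 with hg
  have hg0 : ∀ j, 0 ≤ g j := fun j => by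
    simp only [hg]
    split_ifs
    · exact le_max_left _ _
    · exact le_rfl
  have h1 : ∀ j, orderStat v j ≤ p + g j := fun j => by
    simp only [hg, orderStat]
    split_ifs
    · linarith [le_max_right 0 (v (Tuple.sort v (Fin.rev ⟨j, ‹_›⟩)) - p)]
    · linarith
  have h2 : ∑ j ∈ Finset.range n, g j = ∑ i, max 0 (v i - p) := by
    rw [Finset.sum_range, ← Equiv.sum_comp (Fin.revPerm.trans (Tuple.sort v))
      fun i => max 0 (v i - p)]
    exact Finset.sum_congr rfl fun i _ => by simp [hg]
  have h3 : ∑ j ∈ Finset.range k, g j ≤ ∑ j ∈ Finset.range n, g j := by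
    rw [Finset.sum_subset (Finset.range_mono (le_max_right k n)) (f := g) fun j _ hj => by
      simp [hg, Finset.mem_range.not.1 hj]]
    exact Finset.sum_le_sum_of_subset_of_nonneg (Finset.range_mono (le_max_left k n))
      fun j _ _ => hg0 j
  calc _ ≤ ∑ j ∈ Finset.range k, (p + g j) := Finset.sum_le_sum fun j _ => h1 j
    _ = k * p + ∑ j ∈ Finset.range k, g j := by simp [Finset.sum_add_distrib]
    _ ≤ _ := by linarith

theorem ValueDistribution.lintegral_max_sub_le (F : ValueDistribution) {p B : ℝ}
    (hB : ∀ b, p ≤ b → ∫ u in p..b, F.tail u ≤ B) :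
    ∫⁻ v, ENNReal.ofReal (max 0 (v - p)) ∂F.law ≤ ENNReal.ofReal B := by
  set f : ℕ → ℝ → ENNReal := fun N v => ENNReal.ofReal (max 0 (min v (p + N) - p))
  have hmono : Monotone f := fun N N' h v => ENNReal.ofReal_le_ofReal (by
    have : (N : ℝ) ≤ N' := by exact_mod_cast h
    gcongr)
  have hle : ∀ v, ENNReal.ofReal (max 0 (v - p)) ≤ ⨆ N, f N v := fun v => by
    obtain ⟨N, hN⟩ := exists_nat_ge (v - p)
    refine le_iSup_of_le N ?_
    simp only [f]
    rw [min_eq_left (by linarith)]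
  refine (lintegral_mono hle).trans ?_
  rw [lintegral_iSup (fun N => by simp only [f]; fun_prop) hmono]
  refine iSup_le fun N => ?_
  have hN : p ≤ p + (N : ℝ) := by simp
  refine le_trans (le_of_eq ?_) (ENNReal.ofReal_le_ofReal (hB (p + N) hN))
  rw [← F.integral_tail_eq hN, ofReal_integral_eq_lintegral_ofReal]
  · refine Integrable.of_bound (by fun_prop) (N : ℝ) (ae_of_all _ fun v => ?_)
    rw [Real.norm_of_nonneg (le_max_left _ _)]
    exact max_le (by positivity) (by linarith [min_le_right v (p + N)])
  · exact ae_of_all _ fun v => le_max_left _ _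

theorem welfare_le (F : ValueDistribution) (n k : ℕ) {p B : ℝ} (hp : 0 ≤ p)
    (hB : ∀ b, p ≤ b → ∫ u in p..b, F.tail u ≤ B) :
    welfare F n k ≤ ENNReal.ofReal (k * p + n * B) := by
  have hB0 : 0 ≤ B := by simpa using hB p le_rfl
  have hi : ∀ i : Fin n, ∫⁻ v, ENNReal.ofReal (max 0 (v i - p)) ∂(Measure.pi fun _ : Fin n => F.law)
      ≤ ENNReal.ofReal B := fun i => by
    refine le_trans (le_of_eq ?_) (F.lintegral_max_sub_le hB)
    exact (measurePreserving_eval (fun _ : Fin n => F.law) i).lintegral_comp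
      (f := fun x => ENNReal.ofReal (max 0 (x - p))) (by fun_prop)
  calc welfare F n k ≤ ∫⁻ v, (ENNReal.ofReal (k * p) + ∑ i, ENNReal.ofReal (max 0 (v i - p)))
        ∂(Measure.pi fun _ : Fin n => F.law) := by
        refine lintegral_mono fun v => ?_
        rw [← ENNReal.ofReal_sum_of_nonneg fun i _ => le_max_left _ _,
          ← ENNReal.ofReal_add (by positivity) (Finset.sum_nonneg fun i _ => le_max_left _ _)]
        exact ENNReal.ofReal_le_ofReal (sum_orderStat_le k v hp)
    _ = ENNReal.ofReal (k * p) + ∑ i, ∫⁻ v, ENNReal.ofReal (max 0 (v i - p))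
        ∂(Measure.pi fun _ : Fin n => F.law) := by
        rw [lintegral_add_left measurable_const, lintegral_finsetSum _ fun i _ => by fun_prop]
        simp
    _ ≤ ENNReal.ofReal (k * p) + ∑ _i : Fin n, ENNReal.ofReal B := by
        gcongr with i
        exact hi i
    _ = _ := by
        rw [ENNReal.ofReal_add (by positivity) (by positivity),
          ENNReal.ofReal_mul (Nat.cast_nonneg n)]
        simp

/-- There is a price at which expected demand does not exceed supply and the expected payment of
the interested buyers is at least `regConst lam` times an upper bound on the welfare. -/
theorem ValueDistribution.IsRegular.exists_price {F : ValueDistribution} {lam : ℝ}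
    (hF : F.IsRegular lam) (hlam0 : 0 ≤ lam) (hlam1 : lam < 1) (n k : ℕ) :
    ∃ r p B : ℝ, 0 ≤ r ∧ 0 ≤ p ∧ (∀ b, p ≤ b → ∫ u in p..b, F.tail u ≤ B) ∧
      (0 < k → n * F.tail r ≤ k ∧ regConst lam * (k * p + n * B) ≤ n * (r * F.tail r)) := by
  obtain ⟨r, hr, hlow, hup⟩ := hF.exists_monopoly_price hlam1
  have hr0 : 0 ≤ r := F.lo_nonneg.trans hr
  have hc := regConst_pos hlam1
  have hA : ∀ b, 0 ≤ b → ∫ u in 0..b, F.tail u ≤ r * F.tail r / regConst lam := fun b hb => by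
    rw [le_div_iff₀' hc]
    refine le_trans (mul_le_mul_of_nonneg_left ?_ hc.le)
      -- That lemma needs an upper limit of at least `r`; enlarging `b` only increases the integral.
      (F.regConst_mul_integral_tail_le hlam0 hlam1 hr0 hr hlow hup (le_max_right b r))
    exact intervalIntegral.integral_mono_interval le_rfl hb (le_max_left b r)
      (ae_of_all _ F.tail_nonneg) (F.intervalIntegrable_tail _ _)
  rcases le_or_gt (n * F.tail r) k with h | h
  · refine ⟨r, 0, r * F.tail r / regConst lam, hr0, le_rfl, hA, fun _ => ⟨h, le_of_eq ?_⟩⟩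
    field_simp
    ring
  rcases Nat.eq_zero_or_pos k with rfl | hk
  · exact ⟨r, 0, r * F.tail r / regConst lam, hr0, le_rfl, hA, fun h => absurd h (lt_irrefl _)⟩
  have hk' : (0 : ℝ) < k := by exact_mod_cast hk
  have hn : (0 : ℝ) < n := by
    rcases Nat.eq_zero_or_pos n with rfl | hn
    · simp only [Nat.cast_zero, zero_mul] at h
      linarith
    · exact_mod_cast hn
  have hq : (k : ℝ) / n < F.tail r := by rwa [div_lt_iff₀' hn]
  -- Demand at the monopoly price exceeds supply, so the market-clearing price is higher.
  obtain ⟨p, hp⟩ : ∃ p, F.tail p = k / n :=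
    mem_range_of_exists_le_of_exists_ge F.continuous_tail
      ((F.tendsto_tail_atTop.eventually_le_const (by positivity)).exists) ⟨r, hq.le⟩
  have hrp : r < p := by
    by_contra hle
    have := F.antitone_tail (not_lt.1 hle)
    linarith
  have hp0 : 0 ≤ p := hr0.trans hrp.le
  refine ⟨p, p, p * F.tail p / (1 - lam), hp0, hp0, fun b hb => ?_, fun _ => ⟨?_, ?_⟩⟩
  · rw [le_div_iff₀' (by linarith)]
    refine F.mul_integral_tail_le hlam0 hp0 (hr.trans hrp.le) hb fun v hv hpv => ?_
    refine (hup v hv (hrp.trans hpv)).trans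
      (mul_le_mul_of_nonneg_right ?_ (F.density_pos v hv).le)
    -- Raising the anchor from `r` to `p` changes the affine bound by `(1 - lam) * (p - r) ≥ 0`.
    nlinarith
  · rw [hp]
    field_simp
    exact le_rfl
  · rw [hp]
    have h1 := regConst_mul_le hlam0 hlam1
    have h2 : regConst lam * (k * p + n * (p * (k / n) / (1 - lam))) =
        k * p * (regConst lam * (2 - lam) / (1 - lam)) := by
      have : 1 - lam ≠ 0 := by linarith
      field_simp
      ring
    have h3 : (n : ℝ) * (p * (k / n)) = k * p * 1 := by
      field_simp
    rw [h2, h3]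
    exact mul_le_mul_of_nonneg_left ((div_le_one (by linarith)).2 h1) (by positivity)

end Intermediation

/-! ### Combination of the three factors. -/

theorem mainTheorem4 (n k : ℕ) (F : Intermediation.ValueDistribution) (lam : ℝ)
    (hlam0 : 0 ≤ lam) (hlam1 : lam < 1) (hF : F.IsRegular lam)
    (D : Intermediation.DemandStructure n)
    (U : (l : Fin D.m) → ℕ → ℝ → (D.Buyers l → ℝ) → ℝ) (τ : Fin D.m → ℝ)
    (hU : Intermediation.Admissible F k D U τ) :
    ENNReal.ofReal ((⨅ l, τ l) * (Intermediation.regConst lam / 2) * (1 - 1 / Real.exp 1)) *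
        Intermediation.welfare F n k ≤
      Intermediation.optimalRevenue F k D U := by
  rcases Nat.eq_zero_or_pos k with rfl | hk
  · simp [Intermediation.welfare]
  have ha0 : 0 ≤ ⨅ l, τ l := Real.iInf_nonneg fun l => (hU.tau_mem l).1.le
  have ha : ∀ l, ⨅ l, τ l ≤ τ l := fun l => ciInf_le (Set.finite_range τ).bddBelow l
  have ha1 : ⨅ l, τ l ≤ 1 := by
    -- Without intermediaries the real infimum takes the default value `0`.
    rcases isEmpty_or_nonempty (Fin D.m) with h | ⟨⟨l⟩⟩
    · simp [Real.iInf_of_isEmpty]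
    · exact (ha l).trans (hU.tau_mem l).2
  obtain ⟨r, p, B, hr, hp, hB, h⟩ := hF.exists_price hlam0 hlam1 n k
  obtain ⟨h1, h2⟩ := h hk
  have he : 0 ≤ 1 - 1 / Real.exp 1 := by
    rw [sub_nonneg, div_le_one (Real.exp_pos 1)]
    linarith [Real.add_one_le_exp (1 : ℝ)]
  have hc := Intermediation.regConst_pos hlam1
  have hI := F.le_integral_min_numAbove hk h1
  refine le_trans ?_ (Intermediation.le_optimalRevenue hU hr ha0 ha1 ha)
  refine (mul_le_mul_right (Intermediation.welfare_le F n k hp hB) _).trans ?_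
  rw [← ENNReal.ofReal_mul (by positivity)]
  refine ENNReal.ofReal_le_ofReal ?_
  generalize (⨅ l, τ l) = a at *
  calc a * (Intermediation.regConst lam / 2) * (1 - 1 / Real.exp 1) * (k * p + n * B)
      = a / 2 * (1 - 1 / Real.exp 1) * (Intermediation.regConst lam * (k * p + n * B)) := by ring
    _ ≤ a / 2 * (1 - 1 / Real.exp 1) * (n * (r * F.tail r)) := by gcongr
    _ = r * (a / 2 * ((1 - 1 / Real.exp 1) * (n * F.tail r))) := by ring
    _ ≤ _ := by gcongr
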